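/- **Setting.** Let $\mathbb F_q$ be a finite field, $K\ge N\ge 1$, $\delta\ge 0$. A server has $N$ files; each of $K$ users demands one of them, $\mathbf d\in[N]^K$ is the demand vector and $N_e(\mathbf d)$ the number of distinct files in it. In a linear prefetching scheme $\mathcal M$ every file is split into $n$ subfiles, each a symbol of $\mathbb F_q$, and every user caches $s$ linear combinations of subfiles ($M=s/n$ is the cache size in files). A *$\delta$-error-correcting delivery* of length $\ell$ for $\mathbf d$ is an $\mathbb F_q$-linear encoding of all subfiles into $\ell$ transmitted symbols from which every user, using its cache, recovers its demanded file even if up to $\delta$ of the transmissions are in error; its rate is $\ell/n$. Let $R^*(\mathbf d,\mathcal M,\delta)$ be the minimum of these rates and $R^*_{\rm worst}(\mathcal M,\delta)=\max_{\mathbf d}R^*(\mathbf d,\mathcal M,\delta)$. *CFL prefetching at $M=1/K$.* If $N=K$, each file $X_i$ is split into $n_{\rm CFL}=N$ subfiles and user $k$ caches $X_{1,k}+\dots+X_{N,k}$. If $N<K$, each file is split into $n_{\rm CFL}=NK$ subfiles and user $k$ caches $X_{1,N(k-1)+j}+\dots+X_{N,N(k-1)+j}$ for $j=1,\dots,N$.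 *CFL prefetching at $M\in[0,1/K]$* is memory sharing between the schemes for $M=1/K$ and $M=0$: the fraction $KM$ of each file is split and cached as above, the remaining fraction $1-KM$ is split into $r\ge1$ subfiles and not cached. A delivery consists of $\ell$ linear combinations of subfiles of the first part and $\ell'$ linear combinations of subfiles of the second part, from which every user recovers its demanded file if at most $\delta$ of the $\ell+\ell'$ transmissions are in error; its rate is $\ell\,\frac{KM}{n_{\rm CFL}}+\ell'\,\frac{1-KM}{r}$. The peak rate $R_{\rm CFL}(M)$ is the maximum over $\mathbf d$ of the minimum rate. *Min-rank.* $\kappa(\mathcal M,\mathbf d)$ is the least rank of $A+R$, where the rows of $A$ and $R$ are indexed by pairs (user $k$, subfile index $j$), the row $(k,j)$ of $R$ is the unit vector that selects the subfile $X_{d_k,j}$, and the row $(k,j)$ of $A$ is any vector in the row space of the cache matrix of user $k$. $N_q[\kappa,d]$ denotes the least length of a linear code over $\mathbb F_q$ of dimension $\kappa$ and minimum Hamming distance $d$ (with $N_q[0,d]=0$). **Statement.** For CFL prefetching at $M=1/K$, every $\mathbf d$ with $N_e(\mathbf d)=N$ has min-rank $$\kappa_{\rm worst}=\begin{cases}N(N-1)&\text{if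 }N=K,\\ N^2(K-1)&\text{if }N<K,\end{cases}$$ and $$R^*_{\rm worst}(\mathcal M_{\rm CFL},\delta)=\frac{N_q[\kappa_{\rm worst},2\delta+1]}{n_{\rm CFL}}.$$ Furthermore, for every $r\ge 1$, $R_{\rm CFL}(0)$ and $R_{\rm CFL}(1/K)$ are the peak rates without prefetching ($r$ subfiles per file) and with CFL prefetching at $M=1/K$, and on $[0,1/K]$ the function $R_{\rm CFL}$ equals the lower convex envelope of its values at $M=0$ and $M=1/K$. -/

import Mathlib

open Matrix

section Codes

/-- `C` is a linear code of length `n`, dimension `k` and minimum Hamming distance `d`: every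
non-zero codeword has weight at least `d`, and some non-zero codeword has weight exactly `d`.
The zero code has no non-zero codeword, and is counted as having every minimum distance. -/
def IsLinearCode {F : Type*} [Field F] [DecidableEq F] {n : ℕ}
    (C : Submodule F (Fin n → F)) (k d : ℕ) : Prop :=
  Module.finrank F C = k ∧
  (∀ c ∈ C, c ≠ 0 → d ≤ hammingNorm c) ∧
  (C ≠ ⊥ → ∃ c ∈ C, c ≠ 0 ∧ hammingNorm c = d)

/-- `N_q[k, d]`: the length of the shortest linear code over `F` of dimension `k` and minimum
distance `d`. -/
noncomputable def shortestCodeLength (F : Type*) [Field F] [DecidableEq F] (k d : ℕ) : ℕ :=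
  sInf {n : ℕ | ∃ C : Submodule F (Fin n → F), IsLinearCode C k d}

end Codes

section IndexCoding

/-- An instance of the generalized index coding problem over `F`, with messages indexed by `μ`
and receivers indexed by `ρ`. Receiver `i` requests the combination `request i ⬝ᵥ X` of the
message vector `X` and has the packets `side i *ᵥ X` as side information. -/
structure GICInstance (F μ ρ γ : Type*) where
  request : Matrix ρ μ F
  side : ρ → Matrix γ μ F

/-- The min-rank: the least rank of `A + R`, where the `i`-th row of `A` runs through the row
space of the side-information matrix of receiver `i`, and `R` is the request matrix. -/
noncomputable def GICInstance.minRank {F μ ρ γ : Type*} [Field F] [Fintype μ]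
    (I : GICInstance F μ ρ γ) : ℕ :=
  sInf {k : ℕ | ∃ A : Matrix ρ μ F,
    (∀ i, A i ∈ Submodule.span F (Set.range fun j => I.side i j)) ∧ (A + I.request).rank = k}

end IndexCoding

section Caching

/-- A linear prefetching scheme for `N` files and `K` users. Every file is split into subfiles
indexed by `σ`, each of which is a symbol of `F`; the database is a vector `x`, with `x (n, j)`
the `j`-th subfile of file `n`. User `k` caches the packets `P k *ᵥ x`, indexed by `γ`. -/
abbrev Prefetching (F : Type*) (N K : ℕ) (σ γ : Type) : Type _ :=
  Fin K → Matrix γ (Fin N × σ) F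

/-- The cache size `M` of a user, in units of one file. -/
noncomputable def cacheMemory {F : Type*} {N K : ℕ} {σ γ : Type} [Fintype σ] [Fintype γ]
    (_P : Prefetching F N K σ γ) : ℝ :=
  (Fintype.card γ : ℝ) / (Fintype.card σ : ℝ)

/-- `N_e(d)`: the number of distinct files requested in the demand vector `d`. -/
def numDistinct {N K : ℕ} (d : Fin K → Fin N) : ℕ := (Finset.univ.image d).card

/-- The index coding problem induced by a prefetching scheme and a demand vector: user `k` is
split into one receiver `(k, j)` for every subfile `j` of the file it demands, each having the
cache of user `k` as side information. -/
def inducedGIC {F : Type*} [Field F] {N K : ℕ} {σ γ : Type} [DecidableEq σ]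
    (P : Prefetching F N K σ γ) (d : Fin K → Fin N) :
    GICInstance F (Fin N × σ) (Fin K × σ) γ where
  request := Matrix.of fun i => Pi.single (d i.1, i.2) 1
  side := fun i => P i.1

/-- `L` is the encoding matrix of a linear `δ`-error-correcting delivery of length `ℓ` for the
demand `d`: every user recovers all subfiles of the file it demands from its cache and the
received word, whenever at most `δ` of the `ℓ` transmissions are in error. -/
def IsDelivery {F : Type*} [Field F] [DecidableEq F] {N K : ℕ} {σ γ : Type} [Fintype σ]
    (P : Prefetching F N K σ γ) (d : Fin K → Fin N) (δ : ℕ) {ℓ : ℕ}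
    (L : Matrix (Fin ℓ) (Fin N × σ) F) : Prop :=
  ∀ k : Fin K, ∃ D : (γ → F) → (Fin ℓ → F) → (σ → F),
    ∀ (x : Fin N × σ → F) (e : Fin ℓ → F), hammingNorm e ≤ δ →
      D (P k *ᵥ x) (L *ᵥ x + e) = fun j => x (d k, j)

/-- `R*(d, P, δ)`: the minimum rate, in units of one file, of a linear `δ`-error-correcting
delivery for the demand `d`. -/
noncomputable def demandRate {F : Type*} [Field F] [DecidableEq F] {N K : ℕ} {σ γ : Type}
    [Fintype σ] (P : Prefetching F N K σ γ) (δ : ℕ) (d : Fin K → Fin N) : ℝ :=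
  sInf {R : ℝ | ∃ (ℓ : ℕ) (L : Matrix (Fin ℓ) (Fin N × σ) F),
    IsDelivery P d δ L ∧ R = (ℓ : ℝ) / (Fintype.card σ : ℝ)}

/-- `R*_worst(P, δ) = max_d R*(d, P, δ)`. -/
noncomputable def peakRate {F : Type*} [Field F] [DecidableEq F] {N K : ℕ} {σ γ : Type}
    [Fintype σ] (P : Prefetching F N K σ γ) (δ : ℕ) : ℝ :=
  ⨆ d : Fin K → Fin N, demandRate P δ d

/-- A linear delivery for memory sharing between two prefetching schemes. Every file is divided
into two parts, the first cached according to `P` and the second according to `P'`. The subfiles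
of the two parts have different sizes, so every transmission is a combination of subfiles of one
and the same part: `L` encodes the first part, `L'` the second. Every user recovers both parts of
the file it demands from everything it has received and cached, whenever at most `δ` of all the
`ℓ + ℓ'` transmissions are in error. -/
def IsSharedDelivery {F : Type*} [Field F] [DecidableEq F] {N K : ℕ} {σ γ σ' γ' : Type}
    [Fintype σ] [Fintype σ'] (P : Prefetching F N K σ γ) (P' : Prefetching F N K σ' γ')
    (d : Fin K → Fin N) (δ : ℕ) {ℓ ℓ' : ℕ}
    (L : Matrix (Fin ℓ) (Fin N × σ) F) (L' : Matrix (Fin ℓ') (Fin N × σ') F) : Prop :=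
  ∀ k : Fin K,
    ∃ D : (γ → F) → (γ' → F) → (Fin ℓ → F) → (Fin ℓ' → F) → (σ → F) × (σ' → F),
    ∀ (x : Fin N × σ → F) (x' : Fin N × σ' → F) (e : Fin ℓ → F) (e' : Fin ℓ' → F),
      hammingNorm e + hammingNorm e' ≤ δ →
      D (P k *ᵥ x) (P' k *ᵥ x') (L *ᵥ x + e) (L' *ᵥ x' + e') =
        (fun j => x (d k, j), fun j => x' (d k, j))

/-- The minimum rate for the demand `d` under memory sharing, where the first part is the
fraction `t` of every file and the second part the fraction `1 - t`. A transmission for the first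
part has the size `t / card σ` (in files), one for the second part `(1 - t) / card σ'`. -/
noncomputable def sharedDemandRate {F : Type*} [Field F] [DecidableEq F] {N K : ℕ}
    {σ γ σ' γ' : Type} [Fintype σ] [Fintype σ']
    (P : Prefetching F N K σ γ) (P' : Prefetching F N K σ' γ') (t : ℝ) (δ : ℕ)
    (d : Fin K → Fin N) : ℝ :=
  sInf {R : ℝ | ∃ (ℓ ℓ' : ℕ) (L : Matrix (Fin ℓ) (Fin N × σ) F)
    (L' : Matrix (Fin ℓ') (Fin N × σ') F), IsSharedDelivery P P' d δ L L' ∧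
      R = (ℓ : ℝ) * (t / (Fintype.card σ : ℝ)) + (ℓ' : ℝ) * ((1 - t) / (Fintype.card σ' : ℝ))}

/-- The peak rate under memory sharing. -/
noncomputable def sharedPeakRate {F : Type*} [Field F] [DecidableEq F] {N K : ℕ}
    {σ γ σ' γ' : Type} [Fintype σ] [Fintype σ']
    (P : Prefetching F N K σ γ) (P' : Prefetching F N K σ' γ') (t : ℝ) (δ : ℕ) : ℝ :=
  ⨆ d : Fin K → Fin N, sharedDemandRate P P' t δ d

end Caching

section CFL

/-- The number of coded packets a user caches in the CFL scheme at `M = 1 / K`. -/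
def cflPackets (N K : ℕ) : ℕ := if N = K then 1 else N

/-- `n_CFL`: the number of subfiles into which the CFL scheme splits a file. -/
def nCFL (N K : ℕ) : ℕ := if N = K then N else N * K

/-- CFL prefetching at `M = 1 / K`. The subfiles of a file are arranged in `K` groups of
`cflPackets N K`, subfile `(i, j)` being the `j`-th one of the `i`-th group. User `k` caches, for
every `j`, the sum over all files of the subfiles `(k, j)`. -/
def cflPrefetching (F : Type*) [Field F] (N K : ℕ) :
    Prefetching F N K (Fin K × Fin (cflPackets N K)) (Fin (cflPackets N K)) :=
  fun k => Matrix.of fun j m => if m.2 = (k, j) then 1 else 0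

/-- No prefetching (`M = 0`), with every file split into `r` subfiles. -/
def noPrefetching (F : Type*) (N K r : ℕ) : Prefetching F N K (Fin r) (Fin 0) :=
  fun _ => Matrix.of fun j _ => j.elim0

/-- The peak rate of the CFL scheme for `M ∈ [0, 1 / K]`: the fraction `K * M` of every file is
cached as at `M = 1 / K`, and the rest is not cached and split into `r` subfiles. -/
noncomputable def cflPeakRate (F : Type*) [Field F] [DecidableEq F] (N K r δ : ℕ) (M : ℝ) : ℝ :=
  sharedPeakRate (cflPrefetching F N K) (noPrefetching F N K r) (K * M) δ

/-- The value of the min-rank of the CFL problem for demands with `N_e(d) = N`. -/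
def kappaWorst (N K : ℕ) : ℕ := if N = K then N * (N - 1) else N ^ 2 * (K - 1)

end CFL

/-- The lower convex envelope at `x` of the values of `f` on `S`: the greatest value at `x` of a
convex function on the convex hull of `S` that does not exceed `f` on `S`. -/
noncomputable def lowerConvexEnvelope (S : Set ℝ) (f : ℝ → ℝ) (x : ℝ) : ℝ :=
  sSup {y : ℝ | ∃ g : ℝ → ℝ, ConvexOn ℝ (convexHull ℝ S) g ∧ (∀ s ∈ S, g s ≤ f s) ∧ y = g x}

section Sanity

theorem card_cfl_subfiles (N K : ℕ) :
    Fintype.card (Fin K × Fin (cflPackets N K)) = nCFL N K := by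
  unfold cflPackets nCFL
  split_ifs with h
  · simp [h]
  · simp [Nat.mul_comm]

theorem cacheMemory_cfl (F : Type*) [Field F] {N K : ℕ} (hN : 0 < N) :
    cacheMemory (cflPrefetching F N K) = 1 / K := by
  have hc : (cflPackets N K : ℝ) ≠ 0 := by
    unfold cflPackets
    split_ifs
    · simp
    · exact_mod_cast hN.ne'
  simp only [cacheMemory, Fintype.card_fin, Fintype.card_prod, Nat.cast_mul]
  rw [div_mul_cancel_right₀ hc, one_div]

theorem cacheMemory_noPrefetching (F : Type*) (N K r : ℕ) :
    cacheMemory (noPrefetching F N K r) = 0 := by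
  simp [cacheMemory]

end Sanity

section WellDefined

/-- For `d > 0` the minimum in the definition of `shortestCodeLength` is over a non-empty set. -/
theorem exists_isLinearCode (F : Type*) [Field F] [DecidableEq F] (k d : ℕ) (hd : 0 < d) :
    ∃ (n : ℕ) (C : Submodule F (Fin n → F)), IsLinearCode C k d := by
  set p : Fin (k * d) → Fin k := fun i => (finProdFinEquiv.symm i).1 with hp
  have hps : Function.Surjective p := fun a =>
    ⟨finProdFinEquiv (a, ⟨0, hd⟩), by rw [hp]; simp only [Equiv.symm_apply_apply]⟩
  have hinj := LinearMap.funLeft_injective_of_surjective F F p hps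
  have hw : ∀ x : Fin k → F, hammingNorm (LinearMap.funLeft F F p x) = hammingNorm x * d := by
    intro x
    have : (Finset.univ.filter fun i => LinearMap.funLeft F F p x i ≠ 0) =
        ((Finset.univ.filter fun a => x a ≠ 0) ×ˢ (Finset.univ : Finset (Fin d))).map
          finProdFinEquiv.toEmbedding := by
      ext i
      simp only [Finset.mem_filter, Finset.mem_univ, true_and, Finset.mem_map_equiv,
        Finset.mem_product, and_true, LinearMap.funLeft_apply, hp]
    simp only [hammingNorm]
    rw [this, Finset.card_map, Finset.card_product, Finset.card_univ, Fintype.card_fin]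
  refine ⟨k * d, LinearMap.range (LinearMap.funLeft F F p), ?_, ?_, ?_⟩
  · rw [LinearMap.finrank_range_of_inj hinj]; simp
  · rintro _ ⟨x, rfl⟩ hx
    have hx0 : x ≠ 0 := by rintro rfl; simp at hx
    rw [hw]
    exact Nat.le_mul_of_pos_left _ (hammingNorm_pos_iff.2 hx0)
  · intro hC
    rcases k with _ | k
    · exfalso; apply hC
      rw [eq_bot_iff]
      rintro _ ⟨x, rfl⟩
      rw [Subsingleton.elim x 0, map_zero]
      exact Submodule.zero_mem _
    · refine ⟨_, ⟨Pi.single 0 1, rfl⟩, ?_, ?_⟩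
      · rw [Ne, map_eq_zero_iff _ hinj]; simp
      · rw [hw]
        have : hammingNorm (Pi.single 0 1 : Fin (k + 1) → F) = 1 := by
          simp only [hammingNorm]
          rw [Finset.card_eq_one]
          refine ⟨0, ?_⟩
          ext a
          simp [Pi.single_apply]
        rw [this, one_mul]

/-- A delivery exists for every prefetching scheme and every demand, so that the minimum in the
definition of `demandRate` is over a non-empty set. -/
theorem exists_isDelivery {F : Type*} [Field F] [DecidableEq F] {N K : ℕ} {σ γ : Type}
    [Fintype σ] (P : Prefetching F N K σ γ) (d : Fin K → Fin N) (δ : ℕ) :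
    ∃ (ℓ : ℕ) (L : Matrix (Fin ℓ) (Fin N × σ) F), IsDelivery P d δ L := by
  classical
  let E := (Fintype.equivFin ((Fin N × σ) × Fin (2 * δ + 1)))
  refine ⟨_, Matrix.of fun i m => if (E.symm i).1 = m then 1 else 0, fun k => ?_⟩
  let good : (Fin (Fintype.card ((Fin N × σ) × Fin (2 * δ + 1))) → F) → σ → F → Prop :=
    fun y j v => (Finset.univ.filter fun t => y (E ((d k, j), t)) ≠ v).card ≤ δ
  have huniq : ∀ y j v v', good y j v → good y j v' → v = v' := by
    intro y j v v' h h'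
    by_contra hne
    have hcov : (Finset.univ : Finset (Fin (2 * δ + 1))) ⊆
        (Finset.univ.filter fun t => y (E ((d k, j), t)) ≠ v) ∪
        (Finset.univ.filter fun t => y (E ((d k, j), t)) ≠ v') := by
      intro t _
      simp only [Finset.mem_union, Finset.mem_filter, Finset.mem_univ, true_and]
      by_contra hc
      push Not at hc
      exact hne (hc.1.symm.trans hc.2)
    have h1 := (Finset.card_le_card hcov).trans (Finset.card_union_le _ _)
    simp only [Finset.card_univ, Fintype.card_fin] at h1
    have h2 : _ ≤ δ := h
    have h3 : _ ≤ δ := h'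
    omega
  refine ⟨fun _ y j => if h : ∃ v, good y j v then h.choose else 0, fun x e he => ?_⟩
  funext j
  set y := (Matrix.of fun i m => if (E.symm i).1 = m then (1 : F) else 0) *ᵥ x + e with hy
  have hg : good y j (x (d k, j)) := by
    refine le_trans ?_ he
    refine Finset.card_le_card_of_injOn (fun t => E ((d k, j), t)) ?_ ?_
    · intro t ht
      simpa [hy, Matrix.mulVec, dotProduct] using ht
    · intro t _ t' _ h
      simpa using h
  have hex : ∃ v, good y j v := ⟨_, hg⟩
  simp only [dif_pos hex]
  exact huniq y j _ _ hex.choose_spec hg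

end WellDefined

/-!
Write `c` for the number of packets in the cache of a user, so that a file consists of `K * c`
subfiles and `kappaWorst N K = N * c * (K - 1)` for `N = K` and for `N < K` alike.

By linearity, a matrix `L` is a `δ`-error-correcting delivery if and only if `L *ᵥ z` has weight at
least `2 * δ + 1` for every database `z` that vanishes on the cache of some user but not on the
file that this user demands.

*Lower bounds.* If every file is demanded, choose one user for each file, and let `Z` be the space
of databases on which the caches of these `N` users vanish. Its dimension is at least
`N * K * c - N * c`, and every non-zero element of `Z` has a non-zero file, which one of the chosen
users demands (`exists_submodule_of_surjective`). So the matrices `A + R` of the min-rank problem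
are injective on `Z` (`le_minRank_inducedGIC`), and a delivery maps `Z` onto a code of minimum
distance at least `2 * δ + 1` (`IsDelivery.shortestCodeLength_le`).

*Upper bounds.* If every file is demanded, there is a matrix `A` such that `A + R` vanishes on the
`N * c`-dimensional space of the databases `x (n, (i, j)) = if n = d i then y (n, j) else 0`. If
some file is not demanded, already `R` has rank at most `(N - 1) * K * c`, and this is at most
`N * c * (K - 1)` because `N ≤ K` (`minRank_cflPrefetching_le`). Encoding `A + R` by a shortest
code gives a delivery (`exists_isDelivery_of_minRank_le`).

*Memory sharing.* A shared delivery is nothing but a pair of deliveries (`isSharedDelivery_iff`),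
so that the rate for every single demand is affine in the memory. The demands that contain all
files are the worst ones for both schemes, hence the peak rate is affine as well, and an affine
function is the convex envelope of its values at the end points.
-/

/-! ### Linear codes -/

/-- A code whose minimum distance is at least `d` can be turned into one of the same length and
dimension whose minimum distance is exactly `d`: set to zero all but `d` of the coordinates in the
support of a codeword of least weight. -/
theorem shortestCodeLength_le_of_le_hammingNorm {F : Type*} [Field F] [DecidableEq F]
    {k d ℓ : ℕ} (hd : 0 < d) (f : (Fin k → F) →ₗ[F] (Fin ℓ → F))
    (hf : ∀ v, v ≠ 0 → d ≤ hammingNorm (f v)) : shortestCodeLength F k d ≤ ℓ := by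
  suffices h : ∃ g : (Fin k → F) →ₗ[F] (Fin ℓ → F),
      (∀ v, v ≠ 0 → d ≤ hammingNorm (g v)) ∧ (k ≠ 0 → ∃ v, v ≠ 0 ∧ hammingNorm (g v) = d) by
    obtain ⟨g, hg, hgd⟩ := h
    have hg0 : ∀ v, v ≠ 0 → g v ≠ 0 := fun v hv h0 => by
      have := hg v hv
      rw [h0, hammingNorm_zero] at this
      omega
    have hinj : Function.Injective g :=
      (injective_iff_map_eq_zero g).2 fun v hv => by_contra fun h => hg0 v h hv
    refine Nat.sInf_le ⟨LinearMap.range g, ?_, ?_, ?_⟩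
    · rw [LinearMap.finrank_range_of_inj hinj]
      simp
    · rintro _ ⟨v, rfl⟩ hv
      exact hg v fun h => hv (by rw [h, map_zero])
    · intro hC
      have hk : k ≠ 0 := by
        rintro rfl
        exact hC (LinearMap.range_eq_bot.2 (LinearMap.ext fun v => by
          rw [Subsingleton.elim v 0, map_zero, map_zero]))
      obtain ⟨v, hv, hvd⟩ := hgd hk
      exact ⟨g v, ⟨v, rfl⟩, hg0 v hv, hvd⟩
  -- The zero code has no codeword of weight `d`, and needs none.
  rcases Nat.eq_zero_or_pos k with rfl | hk
  · exact ⟨f, hf, fun h => absurd rfl h⟩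
  have : NeZero k := ⟨hk.ne'⟩
  have hne : ({v | v ≠ 0} : Set (Fin k → F)).Nonempty := ⟨1, one_ne_zero⟩
  obtain ⟨v, hv, hmin⟩ := WellFounded.has_min (measure fun v => hammingNorm (f v)).wf _ hne
  have hmin' : ∀ u, u ≠ 0 → hammingNorm (f v) ≤ hammingNorm (f u) := fun u hu =>
    not_lt.1 (hmin u hu)
  obtain ⟨S, hSv, hS⟩ := Finset.exists_subset_card_eq
    (s := Finset.univ.filter fun i => f v i ≠ 0) (n := hammingNorm (f v) - d) (Nat.sub_le _ _)
  let p : (Fin ℓ → F) →ₗ[F] (Fin ℓ → F) :=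
    LinearMap.pi fun i => if i ∈ S then 0 else LinearMap.proj i
  have hp : ∀ y, (Finset.univ.filter fun i => p y i ≠ 0) =
      (Finset.univ.filter fun i => y i ≠ 0) \ S := by
    intro y
    ext i
    have hpi : p y i = if i ∈ S then 0 else y i := by
      by_cases hi : i ∈ S <;> simp only [p, LinearMap.pi_apply, hi, if_true, if_false] <;> rfl
    by_cases hi : i ∈ S <;> simp [hpi, hi]
  have hvd := hf v hv
  refine ⟨p ∘ₗ f, fun u hu => ?_, fun _ => ⟨v, hv, ?_⟩⟩
  · have h1 := hmin' u hu
    have h2 := Finset.le_card_sdiff S (Finset.univ.filter fun i => f u i ≠ 0)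
    rw [← hp, hS] at h2
    simp only [hammingNorm, LinearMap.comp_apply] at *
    omega
  · have h2 := Finset.card_sdiff_of_subset hSv
    rw [← hp, hS] at h2
    simp only [hammingNorm, LinearMap.comp_apply] at *
    omega

/-- The shortest code of dimension `k` and minimum distance `d`, as an encoding of any space of
dimension at most `k`. -/
theorem exists_linearMap_le_hammingNorm {F V : Type*} [Field F] [DecidableEq F] [AddCommGroup V]
    [Module F V] [FiniteDimensional F V] {k d : ℕ} (hd : 0 < d) (hV : Module.finrank F V ≤ k) :
    ∃ f : V →ₗ[F] (Fin (shortestCodeLength F k d) → F), ∀ v, v ≠ 0 → d ≤ hammingNorm (f v) := by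
  obtain ⟨C, hCk, hCd, -⟩ := Nat.sInf_mem (exists_isLinearCode F k d hd)
  obtain ⟨g, hg⟩ := finrank_le_iff_exists_linearMap.1 (hV.trans_eq hCk.symm)
  refine ⟨C.subtype ∘ₗ g, fun v hv => hCd _ (g v).2 fun h => hv ?_⟩
  exact (map_eq_zero_iff g hg).1 (Subtype.ext h)

/-- A vector of weight at most `2 * δ` is the difference of two vectors of weight at most `δ`. -/
theorem exists_eq_sub_of_hammingNorm_le {ι F : Type*} [Fintype ι] [AddGroup F] [DecidableEq F]
    {δ : ℕ} {v : ι → F} (hv : hammingNorm v ≤ 2 * δ) :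
    ∃ e e' : ι → F, hammingNorm e ≤ δ ∧ hammingNorm e' ≤ δ ∧ v = e - e' := by
  classical
  obtain ⟨S, hSv, hS⟩ := Finset.exists_subset_card_eq
    (s := Finset.univ.filter fun i => v i ≠ 0) (n := hammingNorm v - δ) (Nat.sub_le _ _)
  refine ⟨fun i => if i ∈ S then 0 else v i, fun i => if i ∈ S then - v i else 0, ?_, ?_, ?_⟩
  · have h : (Finset.univ.filter fun i => (if i ∈ S then 0 else v i) ≠ 0) =
        (Finset.univ.filter fun i => v i ≠ 0) \ S := by
      ext i
      by_cases hi : i ∈ S <;> simp [hi]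
    have h2 := Finset.card_sdiff_of_subset hSv
    simp only [hammingNorm] at *
    rw [h]
    omega
  · refine (Finset.card_le_card (t := S) fun i hi => ?_).trans (by omega)
    by_contra h
    simp [h] at hi
  · funext i
    by_cases hi : i ∈ S <;> simp [hi]

/-! ### Deliveries and min-rank -/

section Delivery

variable {F : Type*} [Field F] {N K : ℕ} {σ γ : Type} [Fintype σ]

/-- In a delivery, two databases that agree on the cache of a user but not on the file it demands
have encodings at distance at least `2 * δ + 1`; by linearity this is a statement about their
difference `z`. -/
theorem IsDelivery.le_hammingNorm [DecidableEq F] {P : Prefetching F N K σ γ}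
    {d : Fin K → Fin N} {δ ℓ : ℕ}
    {L : Matrix (Fin ℓ) (Fin N × σ) F} (hL : IsDelivery P d δ L) {k : Fin K}
    {z : Fin N × σ → F} (hP : P k *ᵥ z = 0) (hz : (fun j => z (d k, j)) ≠ 0) :
    2 * δ + 1 ≤ hammingNorm (L *ᵥ z) := by
  by_contra! h
  obtain ⟨e, e', he, he', hee⟩ := exists_eq_sub_of_hammingNorm_le (Nat.lt_succ_iff.1 h)
  -- The user cannot distinguish the database `z` with errors `e'` from `0` with errors `e`.
  obtain ⟨D, hD⟩ := hL k
  have h1 := hD z e' he'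
  have h2 := hD 0 e he
  rw [hee, sub_add_cancel, hP] at h1
  rw [mulVec_zero, mulVec_zero, zero_add, h1] at h2
  exact hz h2

theorem isDelivery_of_le_hammingNorm [DecidableEq F] {P : Prefetching F N K σ γ}
    {d : Fin K → Fin N} {δ ℓ : ℕ}
    {L : Matrix (Fin ℓ) (Fin N × σ) F}
    (h : ∀ k z, P k *ᵥ z = 0 → (fun j => z (d k, j)) ≠ 0 → 2 * δ + 1 ≤ hammingNorm (L *ᵥ z)) :
    IsDelivery P d δ L := by
  classical
  intro k
  -- The decoder returns the demanded file of any database that explains the observation.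
  let good (a : γ → F) (b : Fin ℓ → F) (x : Fin N × σ → F) : Prop :=
    P k *ᵥ x = a ∧ ∃ e, hammingNorm e ≤ δ ∧ L *ᵥ x + e = b
  refine ⟨fun a b => if h : ∃ x, good a b x then fun j => h.choose (d k, j) else 0,
    fun x e he => ?_⟩
  have hex : ∃ x', good (P k *ᵥ x) (L *ᵥ x + e) x' := ⟨x, rfl, e, he, rfl⟩
  simp only [dif_pos hex]
  obtain ⟨hP, e', he', hL⟩ := hex.choose_spec
  by_contra hne
  have h1 := h k (hex.choose - x) (by rw [mulVec_sub, hP, sub_self])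
    (fun h0 => hne (funext fun j => sub_eq_zero.1 (congrFun h0 j)))
  have h2 : L *ᵥ (hex.choose - x) = e - e' := by
    rw [mulVec_sub, sub_eq_sub_iff_add_eq_add, hL, add_comm]
  have h3 : hammingNorm (e - e') ≤ hammingNorm e + hammingNorm e' := by
    have := hammingDist_triangle e' 0 e
    rwa [hammingDist_zero_right, hammingDist_zero_left, hammingDist_eq_hammingNorm,
      neg_add_eq_sub, add_comm] at this
  rw [h2] at h1
  omega

/-- A matrix `A` as in the definition of the min-rank does not contribute to the rows of a user
on a vector that vanishes on the cache of that user. -/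
theorem inducedGIC_add_request_mulVec [DecidableEq σ] {P : Prefetching F N K σ γ}
    {d : Fin K → Fin N} {A : Matrix (Fin K × σ) (Fin N × σ) F}
    (hA : ∀ i, A i ∈ Submodule.span F (Set.range fun j => (inducedGIC P d).side i j))
    {k : Fin K} {z : Fin N × σ → F} (hP : P k *ᵥ z = 0) (j : σ) :
    ((A + (inducedGIC P d).request) *ᵥ z) (k, j) = z (d k, j) := by
  have h0 : A (k, j) ⬝ᵥ z = 0 := by
    refine Submodule.span_induction (p := fun v _ => v ⬝ᵥ z = 0) ?_ (zero_dotProduct z) ?_ ?_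
      (hA (k, j))
    · rintro _ ⟨i, rfl⟩
      exact congrFun hP i
    · intro u v _ _ hu hv
      rw [add_dotProduct, hu, hv, add_zero]
    · intro a v _ hv
      rw [smul_dotProduct, hv, smul_zero]
  rw [add_mulVec, Pi.add_apply]
  simp only [mulVec, h0, zero_add, inducedGIC, of_apply, single_one_dotProduct]

theorem minRank_inducedGIC_le [DecidableEq σ] {P : Prefetching F N K σ γ}
    {d : Fin K → Fin N} {A : Matrix (Fin K × σ) (Fin N × σ) F}
    (hA : ∀ i, A i ∈ Submodule.span F (Set.range fun j => (inducedGIC P d).side i j)) :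
    (inducedGIC P d).minRank ≤ (A + (inducedGIC P d).request).rank :=
  Nat.sInf_le ⟨A, hA, rfl⟩

theorem exists_rank_eq_minRank_inducedGIC [DecidableEq σ] (P : Prefetching F N K σ γ)
    (d : Fin K → Fin N) : ∃ A : Matrix (Fin K × σ) (Fin N × σ) F,
    (∀ i, A i ∈ Submodule.span F (Set.range fun j => (inducedGIC P d).side i j)) ∧
      (A + (inducedGIC P d).request).rank = (inducedGIC P d).minRank :=
  Nat.sInf_mem (s := {k | ∃ A : Matrix (Fin K × σ) (Fin N × σ) F,
    (∀ i, A i ∈ Submodule.span F (Set.range fun j => (inducedGIC P d).side i j)) ∧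
      (A + (inducedGIC P d).request).rank = k}) ⟨_, 0, fun _ => Submodule.zero_mem _, rfl⟩

/-- Concatenating an index code that attains the min-rank with a shortest error-correcting code
yields an error-correcting delivery. -/
theorem exists_isDelivery_of_minRank_le [DecidableEq F] [DecidableEq σ] (P : Prefetching F N K σ γ)
    (d : Fin K → Fin N) (δ : ℕ) {κ : ℕ} (hκ : (inducedGIC P d).minRank ≤ κ) :
    ∃ L : Matrix (Fin (shortestCodeLength F κ (2 * δ + 1))) (Fin N × σ) F,
      IsDelivery P d δ L := by
  obtain ⟨A, hA, hr⟩ := exists_rank_eq_minRank_inducedGIC P d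
  set M := A + (inducedGIC P d).request with hM
  obtain ⟨f, hf⟩ := exists_linearMap_le_hammingNorm (F := F)
    (V := LinearMap.range M.mulVecLin) (Nat.succ_pos (2 * δ)) (hr.trans_le hκ)
  refine ⟨LinearMap.toMatrix' (f ∘ₗ M.mulVecLin.rangeRestrict),
    isDelivery_of_le_hammingNorm fun k z hP hz => ?_⟩
  rw [LinearMap.toMatrix'_mulVec]
  refine hf _ fun h0 => hz (funext fun j => ?_)
  rw [← inducedGIC_add_request_mulVec hA hP j]
  exact congrFun (congrArg Subtype.val h0) (k, j)

/-- If every file is demanded, choose one user for each file. The databases on which the caches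
of these users vanish form a space of codimension at most the number of packets in these caches,
and every non-zero one of them has a file that some user demands and cannot see. -/
theorem exists_submodule_of_surjective [Fintype γ] (P : Prefetching F N K σ γ)
    {d : Fin K → Fin N} (hd : Function.Surjective d) :
    ∃ Z : Submodule F (Fin N × σ → F),
      N * Fintype.card σ ≤ Module.finrank F Z + N * Fintype.card γ ∧
      ∀ z ∈ Z, z ≠ 0 → ∃ k, P k *ᵥ z = 0 ∧ (fun j => z (d k, j)) ≠ 0 := by
  choose u hu using hd
  let φ : (Fin N × σ → F) →ₗ[F] (Fin N × γ → F) :=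
    LinearMap.pi fun m => LinearMap.proj m.2 ∘ₗ (P (u m.1)).mulVecLin
  refine ⟨LinearMap.ker φ, ?_, fun z hz hz0 => ?_⟩
  · have h1 := LinearMap.finrank_range_add_finrank_ker φ
    have h2 := Submodule.finrank_le (LinearMap.range φ)
    simp only [Module.finrank_fintype_fun_eq_card, Fintype.card_prod, Fintype.card_fin] at h1 h2
    omega
  · obtain ⟨⟨n, j⟩, hnj⟩ := Function.ne_iff.1 hz0
    refine ⟨u n, funext fun i => congrFun (LinearMap.mem_ker.1 hz) (n, i), fun h0 => hnj ?_⟩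
    rw [← hu n]
    exact congrFun h0 j

theorem le_minRank_inducedGIC [DecidableEq σ] [Fintype γ] (P : Prefetching F N K σ γ)
    {d : Fin K → Fin N} (hd : Function.Surjective d) :
    N * Fintype.card σ ≤ (inducedGIC P d).minRank + N * Fintype.card γ := by
  classical
  obtain ⟨Z, hZ, hZ0⟩ := exists_submodule_of_surjective P hd
  obtain ⟨A, hA, hr⟩ := exists_rank_eq_minRank_inducedGIC P d
  have hinj : Function.Injective
      ((A + (inducedGIC P d).request).mulVecLin.rangeRestrict ∘ₗ Z.subtype) := by
    refine (injective_iff_map_eq_zero _).2 fun z h0 => by_contra fun hz => ?_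
    obtain ⟨k, hP, hk⟩ := hZ0 z z.2 fun h => hz (Subtype.ext h)
    refine hk (funext fun j => ?_)
    rw [← inducedGIC_add_request_mulVec hA hP j]
    exact congrFun (congrArg Subtype.val h0) (k, j)
  have := LinearMap.finrank_le_finrank_of_injective hinj
  rw [← Matrix.rank, hr] at this
  omega

/-- If every file is demanded, the encodings of the databases in the space provided by
`exists_submodule_of_surjective` form a code of minimum distance at least `2 * δ + 1`. -/
theorem IsDelivery.shortestCodeLength_le [DecidableEq F] [Fintype γ] {P : Prefetching F N K σ γ}
    {d : Fin K → Fin N} (hd : Function.Surjective d) {δ ℓ κ : ℕ}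
    {L : Matrix (Fin ℓ) (Fin N × σ) F} (hL : IsDelivery P d δ L)
    (hκ : κ + N * Fintype.card γ ≤ N * Fintype.card σ) :
    shortestCodeLength F κ (2 * δ + 1) ≤ ℓ := by
  obtain ⟨Z, hZ, hZ0⟩ := exists_submodule_of_surjective P hd
  obtain ⟨f, hf⟩ := finrank_le_iff_exists_linearMap.1
    (show Module.finrank F (Fin κ → F) ≤ Module.finrank F Z by
      rw [Module.finrank_fin_fun]; omega)
  refine shortestCodeLength_le_of_le_hammingNorm (Nat.succ_pos _)
    (L.mulVecLin ∘ₗ Z.subtype ∘ₗ f) fun v hv => ?_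
  obtain ⟨k, hP, hk⟩ := hZ0 (f v) (f v).2 fun h =>
    hv ((map_eq_zero_iff f hf).1 (Subtype.ext h))
  exact hL.le_hammingNorm hP hk

end Delivery

/-! ### The min-rank of CFL prefetching -/

theorem numDistinct_eq_iff_surjective {N K : ℕ} {d : Fin K → Fin N} :
    numDistinct d = N ↔ Function.Surjective d := by
  have h := Finset.card_eq_iff_eq_univ (Finset.univ.image d)
  rw [Fintype.card_fin] at h
  rw [numDistinct, h, Finset.eq_univ_iff_forall]
  simp [Function.Surjective]

theorem exists_surjective_demand {N K : ℕ} (hN : 0 < N) (hNK : N ≤ K) :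
    ∃ d : Fin K → Fin N, Function.Surjective d := by
  have : Nonempty (Fin N) := ⟨⟨0, hN⟩⟩
  exact ⟨_, Function.invFun_surjective (Fin.castLE_injective hNK)⟩

theorem kappaWorst_eq (N K : ℕ) : kappaWorst N K = N * cflPackets N K * (K - 1) := by
  unfold kappaWorst cflPackets
  split_ifs with h
  · rw [h, mul_one]
  · rw [sq]

theorem kappaWorst_add {N K : ℕ} (hK : 0 < K) :
    kappaWorst N K + N * cflPackets N K = N * (K * cflPackets N K) := by
  obtain ⟨k, rfl⟩ : ∃ k, K = k + 1 := ⟨K - 1, by omega⟩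
  rw [kappaWorst_eq, Nat.add_sub_cancel]
  ring

/-- A matrix that vanishes on the image of an injective linear map loses the dimension of its
domain from its rank. -/
theorem Matrix.rank_add_finrank_le {F m n V : Type*} [Field F] [Fintype n] [AddCommGroup V]
    [Module F V] {M : Matrix m n F} {g : V →ₗ[F] (n → F)}
    (hg : Function.Injective g) (h : ∀ v, M *ᵥ g v = 0) :
    M.rank + Module.finrank F V ≤ Fintype.card n := by
  have h1 := LinearMap.finrank_range_add_finrank_ker M.mulVecLin
  have h2 : LinearMap.range g ≤ LinearMap.ker M.mulVecLin := by
    rintro _ ⟨v, rfl⟩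
    exact h v
  have h3 := Submodule.finrank_mono h2
  rw [LinearMap.finrank_range_of_inj hg] at h3
  rw [Module.finrank_fintype_fun_eq_card] at h1
  rw [Matrix.rank]
  omega

/-- The min-rank of CFL prefetching is at most `kappaWorst`. If every file is demanded, the
delivery consists of the subfiles `(n, (i, j))` with `n ≠ d i` and of the differences of the
subfiles `(n, (i, j))` and `(n, (k, j))` with `n = d i = d k`. It vanishes on the databases
`x (n, (i, j)) = if n = d i then y (n, j) else 0`. Otherwise, all demanded subfiles are sent
uncoded. -/
theorem minRank_cflPrefetching_le (F : Type*) [Field F] {N K : ℕ} (hNK : N ≤ K)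
    (d : Fin K → Fin N) :
    (inducedGIC (cflPrefetching F N K) d).minRank ≤ kappaWorst N K := by
  rcases Nat.eq_zero_or_pos K with rfl | hK
  · refine (minRank_inducedGIC_le (A := 0) fun _ => Submodule.zero_mem _).trans ?_
    refine (Matrix.rank_le_card_height _).trans ?_
    simp
  have hκ := kappaWorst_add (N := N) hK
  by_cases hd : Function.Surjective d
  -- Row `(k, (i, j))` of `A + R` is a subfile that is sent if `d i ≠ d k`. If `d i = d k`, it is
  -- that subfile minus packet `j` of user `k`, which vanishes on the range of `g` below.
  · let A : Matrix (Fin K × (Fin K × Fin (cflPackets N K)))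
        (Fin N × (Fin K × Fin (cflPackets N K))) F := Matrix.of fun r =>
      if d r.2.1 = d r.1 then - cflPrefetching F N K r.1 r.2.2 else 0
    have hA : ∀ i, A i ∈ Submodule.span F
        (Set.range fun j => (inducedGIC (cflPrefetching F N K) d).side i j) := by
      rintro ⟨k, i, j⟩
      by_cases h : d i = d k
      · rw [show A (k, i, j) = - cflPrefetching F N K k j from if_pos h]
        exact Submodule.neg_mem _ (Submodule.subset_span ⟨j, rfl⟩)
      · rw [show A (k, i, j) = 0 from if_neg h]
        exact Submodule.zero_mem _
    refine (minRank_inducedGIC_le hA).trans ?_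
    let g : (Fin N × Fin (cflPackets N K) → F) →ₗ[F]
        (Fin N × (Fin K × Fin (cflPackets N K)) → F) :=
      LinearMap.pi fun m => if m.1 = d m.2.1 then LinearMap.proj (m.1, m.2.2) else 0
    have hgapp : ∀ y n i j, g y (n, i, j) = if n = d i then y (n, j) else 0 := by
      intro y n i j
      by_cases h : n = d i <;> simp [g, h]
    have hg : Function.Injective g := by
      refine (injective_iff_map_eq_zero g).2 fun y hy => funext fun ⟨n, j⟩ => ?_
      obtain ⟨i, rfl⟩ := hd n
      have := congrFun hy (d i, i, j)
      rwa [hgapp, if_pos rfl] at this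
    have hcache : ∀ y k j, cflPrefetching F N K k j ⬝ᵥ g y = y (d k, j) := by
      intro y k j
      rw [dotProduct, Fintype.sum_prod_type, Finset.sum_eq_single (d k)]
      · rw [Finset.sum_eq_single (k, j)]
        · simp [cflPrefetching, hgapp]
        · intro b _ hb
          simp [cflPrefetching, hb]
        · simp
      · intro n _ hn
        refine Finset.sum_eq_zero fun b _ => ?_
        by_cases hb : b = (k, j)
        · simp [hb, hgapp, hn]
        · simp [cflPrefetching, hb]
      · simp
    have := Matrix.rank_add_finrank_le (M := A + (inducedGIC (cflPrefetching F N K) d).request)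
      hg fun y => funext fun ⟨k, i, j⟩ => by
        rw [add_mulVec, Pi.add_apply]
        have h2 : ((inducedGIC (cflPrefetching F N K) d).request *ᵥ g y) (k, i, j) =
            g y (d k, i, j) := by
          simp only [inducedGIC, mulVec, of_apply, single_one_dotProduct]
        rw [h2, hgapp]
        by_cases h : d i = d k
        · rw [if_pos h.symm, mulVec, show A (k, i, j) = - cflPrefetching F N K k j from if_pos h,
            neg_dotProduct, hcache, neg_add_cancel, Pi.zero_apply]
        · rw [if_neg (Ne.symm h), mulVec, show A (k, i, j) = 0 from if_neg h, zero_dotProduct,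
            add_zero, Pi.zero_apply]
    simp only [Module.finrank_fintype_fun_eq_card, Fintype.card_prod, Fintype.card_fin] at this
    omega
  -- Some file is not demanded, and at most `(N - 1) * K ≤ N * (K - 1)` groups of subfiles are.
  · obtain ⟨n₀, hn₀⟩ := not_forall.1 hd
    refine (minRank_inducedGIC_le (A := 0) fun _ => Submodule.zero_mem _).trans ?_
    let g : (Fin K × Fin (cflPackets N K) → F) →ₗ[F]
        (Fin N × (Fin K × Fin (cflPackets N K)) → F) :=
      LinearMap.pi fun m => if m.1 = n₀ then LinearMap.proj m.2 else 0
    have hg : Function.Injective g := by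
      refine (injective_iff_map_eq_zero g).2 fun y hy => funext fun s => ?_
      simpa [g] using congrFun hy (n₀, s)
    have := Matrix.rank_add_finrank_le
      (M := 0 + (inducedGIC (cflPrefetching F N K) d).request) hg fun y => funext fun ⟨k, s⟩ => by
        have hk : d k ≠ n₀ := fun h => hn₀ ⟨k, h⟩
        simp [inducedGIC, mulVec, g, hk]
    simp only [Module.finrank_fintype_fun_eq_card, Fintype.card_prod, Fintype.card_fin] at this
    have := Nat.mul_le_mul_right (cflPackets N K) hNK
    omega

theorem minRank_cflPrefetching (F : Type*) [Field F] {N K : ℕ} (hK : 0 < K)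
    (hNK : N ≤ K) {d : Fin K → Fin N} (hd : Function.Surjective d) :
    (inducedGIC (cflPrefetching F N K) d).minRank = kappaWorst N K := by
  refine le_antisymm (minRank_cflPrefetching_le F hNK d) ?_
  have h := le_minRank_inducedGIC (cflPrefetching F N K) hd
  have hκ := kappaWorst_add (N := N) hK
  simp only [Fintype.card_prod, Fintype.card_fin] at h
  omega

/-! ### Rates and memory sharing -/

section Rates

variable {F : Type*} [Field F] [DecidableEq F] {N K : ℕ} {σ γ σ' γ' : Type}
  [Fintype σ] [Fintype σ']

theorem demandRate_le {P : Prefetching F N K σ γ} {d : Fin K → Fin N} {δ ℓ : ℕ}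
    {L : Matrix (Fin ℓ) (Fin N × σ) F} (hL : IsDelivery P d δ L) :
    demandRate P δ d ≤ (ℓ : ℝ) / Fintype.card σ := by
  refine csInf_le ⟨0, ?_⟩ ⟨ℓ, L, hL, rfl⟩
  rintro _ ⟨ℓ', -, -, rfl⟩
  positivity

/-- The infimum in `demandRate` is attained. -/
theorem exists_isDelivery_demandRate_eq (P : Prefetching F N K σ γ) (δ : ℕ) (d : Fin K → Fin N) :
    ∃ (ℓ : ℕ) (L : Matrix (Fin ℓ) (Fin N × σ) F), IsDelivery P d δ L ∧
      demandRate P δ d = (ℓ : ℝ) / Fintype.card σ := by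
  classical
  have hex := exists_isDelivery P d δ
  obtain ⟨L, hL⟩ := Nat.find_spec hex
  refine ⟨Nat.find hex, L, hL, le_antisymm (demandRate_le hL) ?_⟩
  refine le_csInf ⟨_, _, L, hL, rfl⟩ ?_
  rintro _ ⟨ℓ, L', hL', rfl⟩
  gcongr
  exact Nat.find_min' hex ⟨L', hL'⟩

theorem peakRate_eq_of_forall_le {P : Prefetching F N K σ γ} {δ : ℕ} {d₀ : Fin K → Fin N}
    (h : ∀ d, demandRate P δ d ≤ demandRate P δ d₀) : peakRate P δ = demandRate P δ d₀ := by
  have : Nonempty (Fin K → Fin N) := ⟨d₀⟩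
  exact le_antisymm (ciSup_le h) (le_ciSup (Set.finite_range _).bddAbove d₀)

/-- The two parts of the files do not interact: a user recovers both parts under at most `δ`
errors in all if and only if it recovers each of them under at most `δ` errors, since all the
errors may fall on the same part. -/
theorem isSharedDelivery_iff {P : Prefetching F N K σ γ} {P' : Prefetching F N K σ' γ'}
    {d : Fin K → Fin N} {δ ℓ ℓ' : ℕ} {L : Matrix (Fin ℓ) (Fin N × σ) F}
    {L' : Matrix (Fin ℓ') (Fin N × σ') F} :
    IsSharedDelivery P P' d δ L L' ↔ IsDelivery P d δ L ∧ IsDelivery P' d δ L' := by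
  refine ⟨fun h => ⟨fun k => ?_, fun k => ?_⟩, fun ⟨h, h'⟩ k => ?_⟩
  · obtain ⟨D, hD⟩ := h k
    refine ⟨fun a b => (D a (P' k *ᵥ 0) b (L' *ᵥ 0 + 0)).1, fun x e he => ?_⟩
    exact congrArg Prod.fst (hD x 0 e 0 (by simpa using he))
  · obtain ⟨D, hD⟩ := h k
    refine ⟨fun a b => (D (P k *ᵥ 0) a (L *ᵥ 0 + 0) b).2, fun x e he => ?_⟩
    exact congrArg Prod.snd (hD 0 x 0 e (by simpa using he))
  · obtain ⟨D, hD⟩ := h k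
    obtain ⟨D', hD'⟩ := h' k
    refine ⟨fun a a' b b' => (D a b, D' a' b'), fun x x' e e' he => ?_⟩
    exact Prod.ext (hD x e (by omega)) (hD' x' e' (by omega))

theorem sharedDemandRate_eq (P : Prefetching F N K σ γ) (P' : Prefetching F N K σ' γ') {t : ℝ}
    (ht : t ∈ Set.Icc (0 : ℝ) 1) (δ : ℕ) (d : Fin K → Fin N) :
    sharedDemandRate P P' t δ d = t * demandRate P δ d + (1 - t) * demandRate P' δ d := by
  have ht' : 0 ≤ 1 - t := sub_nonneg.2 ht.2
  refine IsLeast.csInf_eq ⟨?_, ?_⟩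
  · obtain ⟨ℓ, L, hL, h⟩ := exists_isDelivery_demandRate_eq P δ d
    obtain ⟨ℓ', L', hL', h'⟩ := exists_isDelivery_demandRate_eq P' δ d
    refine ⟨ℓ, ℓ', L, L', isSharedDelivery_iff.2 ⟨hL, hL'⟩, ?_⟩
    rw [h, h']
    ring
  · rintro _ ⟨ℓ, ℓ', L, L', hLL, rfl⟩
    obtain ⟨hL, hL'⟩ := isSharedDelivery_iff.1 hLL
    refine (add_le_add (mul_le_mul_of_nonneg_left (demandRate_le hL) ht.1)
      (mul_le_mul_of_nonneg_left (demandRate_le hL') ht')).trans_eq ?_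
    ring

/-- If the same demand is worst for both prefetching schemes, memory sharing interpolates linearly
between their peak rates. -/
theorem sharedPeakRate_eq {P : Prefetching F N K σ γ} {P' : Prefetching F N K σ' γ'} {t : ℝ}
    (ht : t ∈ Set.Icc (0 : ℝ) 1) {δ : ℕ} {d₀ : Fin K → Fin N}
    (h : ∀ d, demandRate P δ d ≤ demandRate P δ d₀)
    (h' : ∀ d, demandRate P' δ d ≤ demandRate P' δ d₀) :
    sharedPeakRate P P' t δ = t * peakRate P δ + (1 - t) * peakRate P' δ := by
  have : Nonempty (Fin K → Fin N) := ⟨d₀⟩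
  rw [peakRate_eq_of_forall_le h, peakRate_eq_of_forall_le h', ← sharedDemandRate_eq P P' ht,
    sharedPeakRate]
  refine le_antisymm (ciSup_le fun d => ?_) (le_ciSup (Set.finite_range _).bddAbove d₀)
  rw [sharedDemandRate_eq P P' ht, sharedDemandRate_eq P P' ht]
  exact add_le_add (mul_le_mul_of_nonneg_left (h d) ht.1)
    (mul_le_mul_of_nonneg_left (h' d) (sub_nonneg.2 ht.2))

end Rates

/-! ### The rates of the CFL scheme -/

section CFLRates

variable {F : Type*} [Field F] [DecidableEq F] {N K : ℕ}

theorem demandRate_cflPrefetching_le (hNK : N ≤ K) (δ : ℕ) (d : Fin K → Fin N) :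
    demandRate (cflPrefetching F N K) δ d ≤
      (shortestCodeLength F (kappaWorst N K) (2 * δ + 1) : ℝ) / nCFL N K := by
  obtain ⟨L, hL⟩ := exists_isDelivery_of_minRank_le (cflPrefetching F N K) d δ
    (minRank_cflPrefetching_le F hNK d)
  rw [← card_cfl_subfiles]
  exact demandRate_le hL

theorem demandRate_cflPrefetching (hK : 0 < K) (hNK : N ≤ K) (δ : ℕ) {d : Fin K → Fin N}
    (hd : Function.Surjective d) : demandRate (cflPrefetching F N K) δ d =
      (shortestCodeLength F (kappaWorst N K) (2 * δ + 1) : ℝ) / nCFL N K := by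
  refine le_antisymm (demandRate_cflPrefetching_le hNK δ d) ?_
  obtain ⟨ℓ, L, hL, h⟩ := exists_isDelivery_demandRate_eq (cflPrefetching F N K) δ d
  rw [h, card_cfl_subfiles]
  gcongr
  refine hL.shortestCodeLength_le hd ?_
  simpa only [Fintype.card_prod, Fintype.card_fin] using (kappaWorst_add hK).le

/-- Without prefetching all users have the same information, so that a delivery for a demand that
contains every file is a delivery for every demand. -/
theorem demandRate_noPrefetching_le {r δ : ℕ} {d₀ : Fin K → Fin N}
    (hd : Function.Surjective d₀) (d : Fin K → Fin N) :
    demandRate (noPrefetching F N K r) δ d ≤ demandRate (noPrefetching F N K r) δ d₀ := by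
  obtain ⟨ℓ, L, hL, h⟩ := exists_isDelivery_demandRate_eq (noPrefetching F N K r) δ d₀
  rw [h]
  refine demandRate_le (L := L) fun k => ?_
  obtain ⟨k', hk'⟩ := hd (d k)
  obtain ⟨D, hD⟩ := hL k'
  refine ⟨D, fun x e he => ?_⟩
  rw [← hk']
  exact hD x e he

theorem cflPeakRate_eq (hN : 0 < N) (hNK : N ≤ K) (r δ : ℕ) {M : ℝ}
    (hM : M ∈ Set.Icc (0 : ℝ) (1 / K)) :
    cflPeakRate F N K r δ M = K * M * peakRate (cflPrefetching F N K) δ +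
      (1 - K * M) * peakRate (noPrefetching F N K r) δ := by
  have hK : (0 : ℝ) < K := by exact_mod_cast hN.trans_le hNK
  have ht : (K : ℝ) * M ∈ Set.Icc (0 : ℝ) 1 :=
    ⟨mul_nonneg hK.le hM.1, by have := (le_div_iff₀ hK).1 hM.2; linarith⟩
  obtain ⟨d₀, hd₀⟩ := exists_surjective_demand hN hNK
  refine sharedPeakRate_eq ht (d₀ := d₀) (fun d => ?_) (demandRate_noPrefetching_le hd₀)
  rw [demandRate_cflPrefetching (hN.trans_le hNK) hNK δ hd₀]
  exact demandRate_cflPrefetching_le hNK δ d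

end CFLRates

/-- A function that is affine on an interval is the lower convex envelope of its values at the
end points. -/
theorem lowerConvexEnvelope_pair_eq {f : ℝ → ℝ} {b u v : ℝ} (hb : 0 < b)
    (hf : ∀ x ∈ Set.Icc 0 b, f x = u * x + v) {x : ℝ} (hx : x ∈ Set.Icc 0 b) :
    lowerConvexEnvelope {0, b} f x = f x := by
  have hhull : convexHull ℝ ({0, b} : Set ℝ) = Set.Icc 0 b := by
    rw [convexHull_pair, segment_eq_Icc hb.le]
  have h0 := hf 0 (Set.left_mem_Icc.2 hb.le)
  have h1 := hf b (Set.right_mem_Icc.2 hb.le)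
  -- `f` itself is convex on the interval, and convexity bounds every other candidate by `f`.
  refine IsGreatest.csSup_eq ⟨⟨f, ⟨?_, ?_⟩, fun s _ => le_rfl, rfl⟩, ?_⟩
  · exact convex_convexHull ℝ _
  · rw [hhull]
    intro y hy z hz a c ha hc hac
    have hm := convex_Icc (0 : ℝ) b hy hz ha hc hac
    rw [hf y hy, hf z hz, hf _ hm]
    simp only [smul_eq_mul]
    linear_combination -v * hac
  · rintro _ ⟨g, hg, hgf, rfl⟩
    rw [hhull] at hg
    have hc := hg.2 (Set.left_mem_Icc.2 hb.le) (Set.right_mem_Icc.2 hb.le)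
      (sub_nonneg.2 ((div_le_one hb).2 hx.2)) (div_nonneg hx.1 hb.le) (sub_add_cancel 1 (x / b))
    have hxb : x / b * b = x := div_mul_cancel₀ x hb.ne'
    simp only [smul_eq_mul, mul_zero, zero_add, hxb] at hc
    have g0 := mul_le_mul_of_nonneg_left (hgf 0 (by simp)) (sub_nonneg.2 ((div_le_one hb).2 hx.2))
    have g1 := mul_le_mul_of_nonneg_left (hgf b (by simp)) (div_nonneg hx.1 hb.le)
    rw [h0] at g0
    rw [h1] at g1
    rw [hf x hx]
    linear_combination hc + g0 + g1 + u * hxb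

theorem mainTheorem4 {F : Type*} [Field F] [Fintype F] [DecidableEq F]
    (N K : ℕ) (hN : 0 < N) (hNK : N ≤ K) (δ : ℕ) :
    (∀ d : Fin K → Fin N, numDistinct d = N →
      (inducedGIC (cflPrefetching F N K) d).minRank = kappaWorst N K) ∧
    peakRate (cflPrefetching F N K) δ =
      (shortestCodeLength F (kappaWorst N K) (2 * δ + 1) : ℝ) / (nCFL N K : ℝ) ∧
    ∀ r : ℕ, 0 < r →
      cflPeakRate F N K r δ 0 = peakRate (noPrefetching F N K r) δ ∧
      cflPeakRate F N K r δ (1 / K) = peakRate (cflPrefetching F N K) δ ∧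
      ∀ M ∈ Set.Icc (0 : ℝ) (1 / K),
        cflPeakRate F N K r δ M =
          lowerConvexEnvelope {0, 1 / (K : ℝ)} (cflPeakRate F N K r δ) M := by
  have hK : 0 < K := hN.trans_le hNK
  have hK' : (0 : ℝ) < K := by exact_mod_cast hK
  have hb : (0 : ℝ) < 1 / K := one_div_pos.2 hK'
  refine ⟨fun d hd => minRank_cflPrefetching F hK hNK (numDistinct_eq_iff_surjective.1 hd), ?_,
    fun r _ => ⟨?_, ?_, fun M hM => ?_⟩⟩
  · obtain ⟨d₀, hd₀⟩ := exists_surjective_demand hN hNK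
    have h₀ := demandRate_cflPrefetching (F := F) hK hNK δ hd₀
    rw [← h₀]
    exact peakRate_eq_of_forall_le fun d => h₀ ▸ demandRate_cflPrefetching_le hNK δ d
  · rw [cflPeakRate_eq hN hNK r δ (Set.left_mem_Icc.2 hb.le)]
    ring
  · rw [cflPeakRate_eq hN hNK r δ (Set.right_mem_Icc.2 hb.le), mul_one_div_cancel hK'.ne']
    ring
  · refine (lowerConvexEnvelope_pair_eq (u := K * (peakRate (cflPrefetching F N K) δ -
      peakRate (noPrefetching F N K r) δ)) (v := peakRate (noPrefetching F N K r) δ) hb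
      (fun x hx => ?_) hM).symm
    rw [cflPeakRate_eq hN hNK r δ hx]
    ring
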